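/- Let $q$ be a prime power and let $n,m,h$ be integers with $m\ge 3$ and $2\le h\le n-3$. Let $\mathbf A=(\alpha_1,\dots,\alpha_m)$ be a tuple of nonzero elements of $\mathbb F_{q^n}$ such that $$K_{\mathbf A}=\alpha_1^{q^{m-1}}\alpha_2\,\alpha_3^{q}\cdots\alpha_m^{q^{m-2}}$$ is not a $(1+q+\dots+q^{m-1})$-th power in $\mathbb F_{q^n}$, and let $$V_{\mathbf A,h}=\{(\underline x,\underline x^{q},\dots,\underline x^{q^{h-1}},f_1(\underline x),\dots,f_m(\underline x)) : \underline x\in\mathbb F_{q^n}^m\}\subseteq\mathbb F_{q^n}^{m(h+1)},\qquad f_i(\underline x)=x_i^{q^h}+\alpha_{i+1}x_{i+1}^{q^{h+1}},$$ where indices are read modulo $m$ in $\{1,\dots,m\}$ and powers of $\underline x$ are taken entrywise. Definitions. For $v\in\mathbb F_{q^n}^t$ the rank weight is $\dim_{\mathbb F_q}\langle v_1,\dots,v_t\rangle_{\mathbb F_q}$. A $[t,k,d]_{q^n/q}$ code is a $k$-dimensional $\mathbb F_{q^n}$-subspace of $\mathbb F_{q^n}^t$ whose minimum nonzero rank weight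 is $d$; it is MRD if $nk=\min\{n(t-d+1),t(n-d+1)\}$. Codes $\mathcal C_1,\mathcal C_2\subseteq \mathbb F_{q^n}^t$ are equivalent if $\mathcal C_2=a\,\mathcal C_1 M$ with $a\in\mathbb F_{q^n}^*$ and $M\in\mathrm{GL}(t,q)$. If $U$ is a $t$-dimensional $\mathbb F_q$-subspace of $\mathbb F_{q^n}^k$ that spans $\mathbb F_{q^n}^k$ over $\mathbb F_{q^n}$, a code associated with $U$ is the row space of a $k\times t$ matrix whose columns form an $\mathbb F_q$-basis of $U$. For $0<h<r$, an $\mathbb F_q$-subspace $U$ of an $r$-dimensional $\mathbb F_{q^n}$-space $V$ is $h$-scattered if it spans $V$ over $\mathbb F_{q^n}$ and meets each $h$-dimensional $\mathbb F_{q^n}$-subspace in $\mathbb F_q$-dimension at most $h$; it is maximum $h$-scattered if moreover $\dim_{\mathbb F_q}U=rn/(h+1)$. The previously known codes are those associated with one of the following maximum $h'$-scattered $\mathbb F_q$-subspaces $U$ of a space $V=\mathbb F_{q^n}^{r}$, for some $h'$ and $r$: 1. $U=\bigoplus_j U_j$ where $V=\bigoplus_j V_j$, each $V_j$ is an $(h'+1)$-dimensional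 $\mathbb F_{q^n}$-subspace and $U_j$ is a maximum $h'$-scattered $\mathbb F_q$-subspace of $V_j$; 2. $h'=n-3$, $n\ge4$ even, $r=r'(n-2)/2$ with $r'\ge3$ odd, and $U$ is any maximum $h'$-scattered $\mathbb F_q$-subspace of $V$; 3. $h'=2$, $n=3$, $r\ge 3$, $r\ne5$, and $U$ is any maximum $2$-scattered $\mathbb F_q$-subspace of $V$; 4. $h'=2$, $n=6$, and $U=\bigoplus_j U_j$ where $V=\bigoplus_j V_j$, each $V_j$ is an $\mathbb F_{q^n}$-subspace of dimension $3$ or $4$ and $U_j$ is a maximum $2$-scattered $\mathbb F_q$-subspace of $V_j$. Theorem. There is a code associated with $V_{\mathbf A,h}$, and every code associated with $V_{\mathbf A,h}$ is an $[mn,m(h+1),n-h]_{q^n/q}$ MRD code that is new, that is, equivalent to none of the previously known codes. -/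

import Mathlib

open Module

/-! ## Rank-metric codes over an extension `F / K` of finite fields -/

section Codes

variable (K : Type*) {F : Type*} [Field K] [Field F] [Algebra K F]

/-- The rank weight of `v ∈ F^t`: the `K`-dimension of the `K`-span of its entries. -/
noncomputable def rankWeight {t : ℕ} (v : Fin t → F) : ℕ :=
  finrank K (Submodule.span K (Set.range v))

/-- `C` is an `F`-linear `[t, k, d]` rank-metric code: it is a `k`-dimensional `F`-subspace
of `F^t` with minimum rank distance exactly `d`. -/
def IsRankMetricCode {t : ℕ} (C : Submodule F (Fin t → F)) (k d : ℕ) : Prop :=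
  finrank F C = k ∧ IsLeast {w : ℕ | ∃ v ∈ C, v ≠ 0 ∧ rankWeight K v = w} d

/-- `C` is an `[t, k, d]` MRD code: it attains the Singleton-like bound
`n k ≤ min {n (t - d + 1), t (n - d + 1)}`, where `n = [F : K]`. -/
def IsMRDCode {t : ℕ} (C : Submodule F (Fin t → F)) (k d : ℕ) : Prop :=
  IsRankMetricCode K C k d ∧
    finrank K F * k = min (finrank K F * (t + 1 - d)) (t * (finrank K F + 1 - d))

/-- (Linear) equivalence of rank-metric codes: `C₂ = a C₁ M` for some `M ∈ GL(t, K)` and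
some `a ∈ F`, `a ≠ 0`. -/
def CodeEquivalent {t : ℕ} (C₁ C₂ : Submodule F (Fin t → F)) : Prop :=
  ∃ (M : GL (Fin t) K) (a : Fˣ), ∀ w : Fin t → F,
    w ∈ C₂ ↔ ∃ v ∈ C₁,
      w = (a : F) • Matrix.vecMul v ((M : Matrix (Fin t) (Fin t) K).map (algebraMap K F))

/-- `C` is a code associated with the `q`-system `U`: `U` spans `F^ι` over `F`, and `C` is the
row space of the matrix whose columns are the members of some `K`-basis of `U`. -/
def IsAssociatedCode {ι : Type*} [Fintype ι] {t : ℕ}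
    (C : Submodule F (Fin t → F)) (U : Submodule K (ι → F)) : Prop :=
  Submodule.span F (U : Set (ι → F)) = ⊤ ∧
    ∃ u : Basis (Fin t) K U, ∀ c : Fin t → F,
      c ∈ C ↔ ∃ v : ι → F, c = fun j => v ⬝ᵥ (u j : ι → F)

end Codes

/-! ## `h`-scattered subspaces -/

section Scattered

variable {K F V : Type*} [Field K] [Field F] [Algebra K F]
  [AddCommGroup V] [Module K V] [Module F V] [IsScalarTower K F V]

/-- `S` is an `h`-scattered `K`-subspace of the `F`-vector space `W` (a subspace of `V`). -/
def IsScatteredIn (h : ℕ) (W : Submodule F V) (S : Submodule K V) : Prop :=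
  0 < h ∧ h < finrank F W ∧ Submodule.span F (S : Set V) = W ∧
    ∀ H : Submodule F V, H ≤ W → finrank F H = h →
      finrank K (S ⊓ H.restrictScalars K : Submodule K V) ≤ h

/-- `S` is a maximum `h`-scattered `K`-subspace of `W`: its dimension attains the bound
`dim_K S ≤ r n / (h + 1)`, where `r = dim_F W` and `n = [F : K]`. -/
def IsMaxScatteredIn (h : ℕ) (W : Submodule F V) (S : Submodule K V) : Prop :=
  IsScatteredIn h W S ∧ (h + 1) * finrank K S = finrank F W * finrank K F

variable (F) in
/-- `U` is the direct sum of maximum `h`-scattered `K`-subspaces of `F`-subspaces `W j`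
that have dimensions in `D` and decompose `V` as a direct sum. -/
def IsDirectSumOfMaxScattered (h : ℕ) (D : Set ℕ) (U : Submodule K V) : Prop :=
  ∃ (s : ℕ) (W : Fin s → Submodule F V) (S : Fin s → Submodule K V),
    DirectSum.IsInternal W ∧
    (∀ j, finrank F (W j) ∈ D ∧ IsMaxScatteredIn h (W j) (S j)) ∧
    U = ⨆ j, S j

variable (F) in
/-- The previously known maximum `h`-scattered subspaces of `V`, with `r = dim_F V` and
`n = [F : K]`:
* direct sums of maximum `h`-scattered subspaces of `(h + 1)`-dimensional spaces;
* maximum `(n - 3)`-scattered subspaces for `n ≥ 4` even, `r = r' (n - 2) / 2`, `r' ≥ 3` odd;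
* maximum `2`-scattered subspaces for `n = 3`, `r ≥ 3`, `r ≠ 5`;
* for `n = 6`, direct sums of maximum `2`-scattered subspaces of spaces of dimension 3 or 4. -/
def IsKnownMaxScattered (h : ℕ) (U : Submodule K V) : Prop :=
  IsDirectSumOfMaxScattered F h {h + 1} U ∨
  (Even (finrank K F) ∧ 4 ≤ finrank K F ∧ h + 3 = finrank K F ∧
    (∃ r : ℕ, Odd r ∧ 3 ≤ r ∧ 2 * finrank F V = r * (finrank K F - 2)) ∧
    IsMaxScatteredIn h (⊤ : Submodule F V) U) ∨
  (h = 2 ∧ finrank K F = 3 ∧ 3 ≤ finrank F V ∧ finrank F V ≠ 5 ∧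
    IsMaxScatteredIn h (⊤ : Submodule F V) U) ∨
  (h = 2 ∧ finrank K F = 6 ∧ IsDirectSumOfMaxScattered F h {3, 4} U)

end Scattered

/-- The previously known codes: those associated with a previously known maximum `h`-scattered
subspace of some `F^k`, for some `h`. -/
def IsKnownCode (K : Type*) {F : Type*} [Field K] [Field F] [Algebra K F] {t : ℕ}
    (C : Submodule F (Fin t → F)) : Prop :=
  ∃ (h k : ℕ) (U : Submodule K (Fin k → F)),
    IsKnownMaxScattered F h U ∧ IsAssociatedCode K C U

/-! ## The subspaces `V_{A,h}` -/

section Family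

variable (K : Type*) {F : Type*} [Field K] [Fintype K] [Field F] [Algebra K F]

theorem add_pow_card_pow (a b : F) (j : ℕ) :
    (a + b) ^ Fintype.card K ^ j = a ^ Fintype.card K ^ j + b ^ Fintype.card K ^ j := by
  induction j with
  | zero => simp
  | succ j ih =>
    have key : ∀ x y : F,
        (x + y) ^ Fintype.card K = x ^ Fintype.card K + y ^ Fintype.card K :=
      fun x y => (FiniteField.frobeniusAlgHom K F).map_add' x y
    rw [pow_succ, pow_mul, pow_mul, pow_mul, ih, key]

theorem smul_pow_card_pow (c : K) (a : F) (j : ℕ) :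
    (c • a) ^ Fintype.card K ^ j = c • a ^ Fintype.card K ^ j := by
  rw [smul_pow, FiniteField.pow_card_pow]

/-- The `K`-linear map `x ↦ (x, x^q, …, x^{q^{h-1}}, f_1(x), …, f_m(x))` from `F^m` to
`F^{m(h+1)}`, where `q = |K|`, powers of the vector `x` are taken entrywise, and
`f_i(x) = x_i^{q^h} + α_{i+1} x_{i+1}^{q^{h+1}}` with the index `i + 1` read cyclically.
The coordinate `(j, i)` is the `i`-th entry of the `j`-th block of length `m`, all counted
from `0`; so `A i` is `α_{i+1}`, and `finRotate m` is the cyclic shift `i ↦ i + 1`. -/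
def familyMap {m : ℕ} (A : Fin m → F) (h : ℕ) : (Fin m → F) →ₗ[K] (Fin (h + 1) × Fin m → F) where
  toFun x p :=
    if (p.1 : ℕ) < h then x p.2 ^ Fintype.card K ^ (p.1 : ℕ)
    else x p.2 ^ Fintype.card K ^ h +
      A (finRotate m p.2) * x (finRotate m p.2) ^ Fintype.card K ^ (h + 1)
  map_add' x y := by
    funext p
    simp only [Pi.add_apply, add_pow_card_pow]
    split_ifs <;> ring
  map_smul' c x := by
    funext p
    simp only [Pi.smul_apply, smul_pow_card_pow, RingHom.id_apply]
    split_ifs <;> simp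

/-- The `K`-subspace `V_{A,h}` of `F^{m(h+1)}`. -/
def familySubspace {m : ℕ} (A : Fin m → F) (h : ℕ) : Submodule K (Fin (h + 1) × Fin m → F) :=
  LinearMap.range (familyMap K A h)

/-- `K_A = α_1^{q^{m-1}} α_2 α_3^q ⋯ α_m^{q^{m-2}}`, where `q = |K|`. -/
def familyConst {m : ℕ} (A : Fin m → F) : F :=
  ∏ i : Fin m, A (finRotate m i) ^ Fintype.card K ^ (i : ℕ)

/-- The set `𝒜` of the tuples of nonzero elements for which `K_A` is not a
`(1 + q + ⋯ + q^{m-1})`-th power in `F`. -/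
def admissibleTuples (m : ℕ) : Set (Fin m → F) :=
  {A | (∀ i, A i ≠ 0) ∧
    ¬ ∃ y : F, y ^ (∑ i ∈ Finset.range m, Fintype.card K ^ i) = familyConst K A}

end Family

/-!
Write `n = [F : K]`, `U = V_{A,h}`, and let `T` be the bijective `q`-semilinear map
`x ↦ (α_{i+1} x_{i+1}^q)_i` on `F^m`. The condition on `K_A` is used only through the fact that
`T` has no eigenvector: an equation `T w = λ w` relates each `w_i` to the next entry, and
going once around the cycle gives `K_A = (λ / w_0^{q-1})^{1 + q + ⋯ + q^{m-1}}`
(`no_cyclic_eigenvector`).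

*Minimum distance.* The codeword of a linear form `v` has rank weight `dim_K v(U)`. As a function
of the parameter `x`, the form `v` is a sum of `q`-polynomials in the single variables `x_i`, of
`q`-degree at most `h + 1`. If `v(U)` had dimension less than `n - h`, the trace adjoints of these
polynomials, again of `q`-degree at most `h + 1`, would have a common space of zeros of dimension
at least `h + 1`, and so would be proportional. Comparing the two lowest coefficients of the
adjoints turns the inverses of the `v_{h,i}` into an eigenvector of `T`
(`finrank_le_of_forms_mem`). That the weight `n - h` occurs is the Singleton bound
(`exists_form_finrank_le`).

*Newness.* Equivalent codes have `F`-isomorphic `q`-systems (`exists_equiv_of_codeEquivalent`), so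
it suffices to see that `U` is isomorphic to none of the known maximum scattered subspaces. If `U`
is a direct sum, the projection onto a summand is an `F`-linear map `P` with `P(U) ⊆ U`. On
parameters it induces a `K`-linear endomorphism of `F^m` whose coordinates are `q`-polynomials, and
since `h + 3 ≤ n` a comparison of coefficients shows that it is `F`-linear and commutes with `T`
up to a Frobenius twist. Hence `dim_K P(U)` is a multiple of `n`; were it `n`, the image would be
a `T`-invariant line, which does not exist (`finrank_map_of_invariant`). But the direct sums in
question have a summand of dimension `n`, or of dimension `8` when `n = 6`. The two remaining
families are excluded by `dim_K U = m n` and `h + 3 ≤ n`: one needs an odd `r'` equal to `2 m`, the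
other needs `n = 3`.
-/

/-! ### `q`-polynomials -/

section QPolynomials

variable {K F : Type*} [Field K] [Fintype K] [Field F] [Algebra K F]

theorem sum_pow_card_pow {ι : Type*} (s : Finset ι) (f : ι → F) (j : ℕ) :
    (∑ i ∈ s, f i) ^ Fintype.card K ^ j = ∑ i ∈ s, f i ^ Fintype.card K ^ j := by
  classical
  induction s using Finset.induction_on with
  | empty => simp [Fintype.card_ne_zero]
  | insert a s ha ih => rw [Finset.sum_insert ha, Finset.sum_insert ha, add_pow_card_pow, ih]

/-- A nonzero `q`-polynomial of `q`-degree less than `d` cannot vanish on a `K`-subspace of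
dimension at least `d`: its degree is at most `q ^ (d - 1)`. -/
theorem coeff_eq_zero_of_vanishing [Finite F] {d : ℕ} {c : ℕ → F} (D : Submodule K F)
    (hd : d ≤ finrank K D)
    (hv : ∀ x ∈ D, ∑ j ∈ Finset.range d, c j * x ^ Fintype.card K ^ j = 0) {j : ℕ} (hj : j < d) :
    c j = 0 := by
  classical
  have hq : 1 < Fintype.card K := Fintype.one_lt_card
  have : Fintype F := Fintype.ofFinite F
  set p : Polynomial F :=
    ∑ j ∈ Finset.range d, Polynomial.monomial (Fintype.card K ^ j) (c j) with hp
  have hdeg : p.natDegree ≤ Fintype.card K ^ (d - 1) := by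
    refine Polynomial.natDegree_sum_le_of_forall_le _ _ fun i hi => ?_
    refine (Polynomial.natDegree_monomial_le _).trans ?_
    exact Nat.pow_le_pow_right hq.le (by rw [Finset.mem_range] at hi; omega)
  have hcard : p.natDegree < (Finset.univ.filter (· ∈ D)).card := by
    have h1 : (Finset.univ.filter (· ∈ D)).card = Fintype.card K ^ finrank K D := by
      rw [← Fintype.card_subtype]
      exact Module.card_eq_pow_finrank (K := K) (V := D)
    rw [h1]
    exact hdeg.trans_lt (Nat.pow_lt_pow_right hq (by omega))
  have h0 : p = 0 := by
    refine Polynomial.eq_zero_of_natDegree_lt_card_of_eval_eq_zero' p _ (fun x hx => ?_) hcard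
    have := hv x (by simpa using hx)
    rw [hp, Polynomial.eval_finsetSum, ← this]
    exact Finset.sum_congr rfl fun i _ => Polynomial.eval_monomial
  have h1 : p.coeff (Fintype.card K ^ j) = c j := by
    rw [hp, Polynomial.finsetSum_coeff, Finset.sum_eq_single j]
    · simp
    · intro i _ hij
      rw [Polynomial.coeff_monomial, if_neg]
      exact fun h => hij (Nat.pow_right_injective hq h)
    · intro h
      exact absurd (Finset.mem_range.2 hj) h
  rw [← h1, h0, Polynomial.coeff_zero]

/-- Comparison of coefficients between a `q`-polynomial and the `q ^ s`-th power of another one,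
as functions on `F`, when all the `q`-degrees are smaller than `[F : K]`. -/
theorem coeff_eq_of_eq_pow [Finite F] {a b s : ℕ} {c d : ℕ → F}
    (ha : a ≤ finrank K F) (hb : s + b ≤ finrank K F)
    (hcd : ∀ x : F, ∑ j ∈ Finset.range a, c j * x ^ Fintype.card K ^ j =
      (∑ j ∈ Finset.range b, d j * x ^ Fintype.card K ^ j) ^ Fintype.card K ^ s)
    {k : ℕ} (hk : k < finrank K F) :
    (if k < a then c k else 0) =
      if s ≤ k ∧ k < s + b then d (k - s) ^ Fintype.card K ^ s else 0 := by
  have key := coeff_eq_zero_of_vanishing (K := K) (F := F) (d := finrank K F)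
    (c := fun k => (if k < a then c k else 0) -
      if s ≤ k ∧ k < s + b then d (k - s) ^ Fintype.card K ^ s else 0) ⊤
    (by rw [finrank_top]) (fun x _ => ?_) hk
  · exact sub_eq_zero.1 key
  · simp only [sub_mul, Finset.sum_sub_distrib]
    rw [sub_eq_zero]
    have h1 : ∑ k ∈ Finset.range (finrank K F),
        (if k < a then c k else 0) * x ^ Fintype.card K ^ k =
        ∑ j ∈ Finset.range a, c j * x ^ Fintype.card K ^ j := by
      symm
      rw [← Finset.sum_subset (Finset.range_mono ha)]
      · refine Finset.sum_congr rfl fun j hj => ?_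
        rw [if_pos (Finset.mem_range.1 hj)]
      · intro j _ hj
        rw [if_neg (by simpa using hj), zero_mul]
    have h2 : ∑ k ∈ Finset.range (finrank K F),
        (if s ≤ k ∧ k < s + b then d (k - s) ^ Fintype.card K ^ s else 0) *
          x ^ Fintype.card K ^ k =
        ∑ k ∈ Finset.Ico s (s + b), d (k - s) ^ Fintype.card K ^ s * x ^ Fintype.card K ^ k := by
      symm
      rw [← Finset.sum_subset (s₁ := Finset.Ico s (s + b)) (s₂ := Finset.range (finrank K F))]
      · refine Finset.sum_congr rfl fun j hj => ?_
        rw [if_pos (Finset.mem_Ico.1 hj)]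
      · intro j hj
        rw [Finset.mem_Ico] at hj
        rw [Finset.mem_range]
        omega
      · intro j _ hj
        rw [if_neg (by simpa using hj), zero_mul]
    rw [h1, h2, hcd, sum_pow_card_pow, Finset.sum_Ico_eq_sum_range, Nat.add_sub_cancel_left]
    refine Finset.sum_congr rfl fun j _ => ?_
    rw [mul_pow, ← pow_mul, ← pow_add, Nat.add_sub_cancel_left, Nat.add_comm j s]

end QPolynomials

/-! ### The cyclic system behind the condition on `K_A` -/

section Cyclic

variable {K F : Type*} [Field K] [Fintype K] [Field F]

open Fin.NatCast in
/-- For an admissible tuple the `q`-semilinear map `w ↦ (α_{i+1} w_{i+1}^q)_i` has no eigenvector.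
Going once around the cycle expresses `K_A` as a `(1 + q + ⋯ + q^{m-1})`-th power. -/
theorem no_cyclic_eigenvector {m : ℕ} {A : Fin m → F} (hA : A ∈ admissibleTuples K m)
    {w : Fin m → F} (hw : w ≠ 0) (l : F)
    (h : ∀ i, A (finRotate m i) * w (finRotate m i) ^ Fintype.card K = l * w i) : False := by
  obtain ⟨hA0, hA⟩ := hA
  obtain _ | m := m
  · exact hw (Subsingleton.elim _ _)
  have hrot : ∀ k : ℕ, finRotate (m + 1) (k : Fin (m + 1)) = ((k + 1 : ℕ) : Fin (m + 1)) := by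
    intro k
    rw [finRotate_apply]
    push_cast
    rfl
  have hq : 1 < Fintype.card K := Fintype.one_lt_card
  have hw0 : w 0 ≠ 0 := by
    intro h0
    apply hw
    have : ∀ k : ℕ, w (k : Fin (m + 1)) = 0 := by
      intro k
      induction k with
      | zero => simpa using h0
      | succ k ih =>
        have := h (k : Fin (m + 1))
        rw [ih, mul_zero, hrot] at this
        exact eq_zero_of_pow_eq_zero ((mul_eq_zero.1 this).resolve_left (hA0 _))
    funext i
    simpa using this i
  have key : ∀ M : ℕ,
      (∏ k ∈ Finset.range M, A (finRotate (m + 1) (k : Fin (m + 1))) ^ Fintype.card K ^ k) *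
        w (M : Fin (m + 1)) ^ Fintype.card K ^ M =
      l ^ (∑ k ∈ Finset.range M, Fintype.card K ^ k) * w 0 := by
    intro M
    induction M with
    | zero => simp
    | succ M ih =>
      have h1 := congrArg (· ^ Fintype.card K ^ M) (h (M : Fin (m + 1)))
      simp only [mul_pow, ← pow_mul, ← pow_succ'] at h1
      rw [Finset.prod_range_succ, Finset.sum_range_succ, ← hrot, mul_assoc, h1, pow_add]
      calc _ = l ^ Fintype.card K ^ M * ((∏ k ∈ Finset.range M,
            A (finRotate (m + 1) (k : Fin (m + 1))) ^ Fintype.card K ^ k) *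
              w (M : Fin (m + 1)) ^ Fintype.card K ^ M) := by ring
        _ = _ := by rw [ih]; ring
  have hM := key (m + 1)
  have hprod : ∏ k ∈ Finset.range (m + 1),
      A (finRotate (m + 1) (k : Fin (m + 1))) ^ Fintype.card K ^ k = familyConst K A := by
    rw [familyConst, ← Fin.prod_univ_eq_prod_range
      (fun k => A (finRotate (m + 1) (k : Fin (m + 1))) ^ Fintype.card K ^ k)]
    simp
  have hgeom : Fintype.card K ^ (m + 1) =
      (Fintype.card K - 1) * (∑ k ∈ Finset.range (m + 1), Fintype.card K ^ k) + 1 := by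
    have := Nat.geomSum_eq hq (m + 1)
    have h2 := Nat.sub_one_dvd_pow_sub_one (Fintype.card K) (m + 1)
    rw [this, Nat.mul_div_cancel' h2]
    have := Nat.one_le_pow (m + 1) (Fintype.card K) (by omega)
    omega
  rw [hprod, Fin.natCast_self, hgeom, pow_succ, ← mul_assoc, pow_mul] at hM
  have hM' := mul_right_cancel₀ hw0 hM
  refine hA ⟨l / w 0 ^ (Fintype.card K - 1), ?_⟩
  rw [div_pow, ← hM', mul_div_assoc, div_self (pow_ne_zero _ (pow_ne_zero _ hw0)), mul_one]

end Cyclic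

/-! ### Linear forms on `V_{A,h}` -/

section LinearForms

variable {K F : Type*} [Field K] [Fintype K] [Field F] [Algebra K F]

/-- The coefficient of `x_i ^ (q ^ j)` in the linear form `v` evaluated at the point of `V_{A,h}`
with parameter `x`; meaningful for `j ≤ h + 1`. -/
def formCoeff {m h : ℕ} (A : Fin m → F) (v : Fin (h + 1) × Fin m → F) (i : Fin m) (j : ℕ) : F :=
  if hj : j < h + 1 then v (⟨j, hj⟩, i) else A i * v (Fin.last h, (finRotate m).symm i)

theorem formCoeff_last {m h : ℕ} (A : Fin m → F) (v : Fin (h + 1) × Fin m → F) (i : Fin m) :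
    formCoeff A v i h = v (Fin.last h, i) := by
  rw [formCoeff, dif_pos (Nat.lt_succ_self h)]
  rfl

theorem formCoeff_top {m h : ℕ} (A : Fin m → F) (v : Fin (h + 1) × Fin m → F) (i : Fin m) :
    formCoeff A v i (h + 1) = A i * v (Fin.last h, (finRotate m).symm i) := by
  rw [formCoeff, dif_neg (lt_irrefl _)]

theorem dotProduct_familyMap_single {m h : ℕ} (A : Fin m → F) (v : Fin (h + 1) × Fin m → F)
    (i : Fin m) (x : F) :
    v ⬝ᵥ familyMap K A h (Pi.single i x) =
      ∑ j ∈ Finset.range (h + 2), formCoeff A v i j * x ^ Fintype.card K ^ j := by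
  have hq : ∀ j, Fintype.card K ^ j ≠ 0 := fun j => pow_ne_zero _ Fintype.card_ne_zero
  have hs : ∀ (i' : Fin m) (j : ℕ), (Pi.single i x : Fin m → F) i' ^ Fintype.card K ^ j =
      if i' = i then x ^ Fintype.card K ^ j else 0 := by
    intro i' j
    rw [Pi.single_apply]
    split_ifs
    · rfl
    · exact zero_pow (hq j)
  rw [dotProduct, Fintype.sum_prod_type, Fin.sum_univ_castSucc, Finset.sum_range_succ,
    Finset.sum_range_succ, formCoeff_top, formCoeff_last, add_assoc]
  congr 1
  · rw [← Fin.sum_univ_eq_sum_range (fun j => formCoeff A v i j * x ^ Fintype.card K ^ j)]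
    refine Finset.sum_congr rfl fun j _ => ?_
    have hj : (j : ℕ) < h + 1 := by omega
    simp only [familyMap, LinearMap.coe_mk, AddHom.coe_mk, Fin.val_castSucc, j.2, if_true, hs,
      mul_ite, mul_zero, Finset.sum_ite_eq', Finset.mem_univ]
    rw [formCoeff, dif_pos hj]
    rfl
  · simp only [familyMap, LinearMap.coe_mk, AddHom.coe_mk, Fin.val_last, lt_irrefl, if_false, hs,
      mul_add, Finset.sum_add_distrib, mul_ite, mul_zero, Finset.sum_ite_eq', Finset.mem_univ,
      if_true]
    congr 1
    simp only [← Equiv.eq_symm_apply, Finset.sum_ite_eq', Finset.mem_univ, if_true,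
      Equiv.apply_symm_apply]
    ring

theorem dotProduct_familyMap {m h : ℕ} (A : Fin m → F) (v : Fin (h + 1) × Fin m → F)
    (x : Fin m → F) :
    v ⬝ᵥ familyMap K A h x = ∑ i, v ⬝ᵥ familyMap K A h (Pi.single i (x i)) := by
  conv_lhs => rw [← Finset.univ_sum_single x, map_sum, dotProduct_sum]

theorem familyMap_apply_zero {m h : ℕ} (hh : 0 < h) (A : Fin m → F) (x : Fin m → F) (i : Fin m) :
    familyMap K A h x (0, i) = x i := by
  simp [familyMap, hh]

theorem familyMap_injective {m h : ℕ} (hh : 0 < h) (A : Fin m → F) :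
    Function.Injective (familyMap K A h) := by
  intro x y hxy
  funext i
  rw [← familyMap_apply_zero (K := K) hh A x, hxy, familyMap_apply_zero hh]

theorem finrank_familySubspace [Finite F] {m h : ℕ} (hh : 0 < h) (A : Fin m → F) :
    finrank K (familySubspace K A h) = m * finrank K F := by
  rw [familySubspace, LinearMap.finrank_range_of_inj (familyMap_injective hh A),
    Module.finrank_pi_fintype]
  simp

end LinearForms

/-! ### The minimum distance -/

section Distance

variable {K F : Type*} [Field K] [Fintype K] [Field F] [Finite F] [Algebra K F]

theorem trace_pow_card_pow (y : F) (j : ℕ) :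
    Algebra.trace K F (y ^ Fintype.card K ^ j) = Algebra.trace K F y := by
  induction j with
  | zero => simp
  | succ j ih =>
    rw [pow_succ, pow_mul, ← ih]
    exact Algebra.trace_eq_of_algEquiv (FiniteField.frobeniusAlgEquivOfAlgebraic K F) _

/-- The trace adjoint of a `q`-polynomial of `q`-degree at most `d`, twisted by the `d`-th power of
the Frobenius map, vanishes on the trace-orthogonal of the image of the `q`-polynomial. -/
theorem adjoint_vanishes {d : ℕ} {a : ℕ → F} {y : F}
    (hy : ∀ x : F, Algebra.trace K F
      (y * ∑ j ∈ Finset.range (d + 1), a j * x ^ Fintype.card K ^ j) = 0) :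
    ∑ s ∈ Finset.range (d + 1), a (d - s) ^ Fintype.card K ^ s * y ^ Fintype.card K ^ s = 0 := by
  apply (traceForm_nondegenerate K F).1
  intro z
  obtain ⟨x, rfl⟩ : ∃ x : F, x ^ Fintype.card K ^ d = z := by
    have hinj : Function.Injective fun x : F => x ^ Fintype.card K ^ d := by
      intro x x' hx
      have h1 : (x - x') ^ Fintype.card K ^ d = 0 := by
        have h2 := add_pow_card_pow K (x - x') x' d
        rw [sub_add_cancel] at h2
        exact add_right_cancel (h2.symm.trans (hx.trans (zero_add _).symm))
      exact sub_eq_zero.1 (eq_zero_of_pow_eq_zero h1)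
    exact Finite.surjective_of_injective hinj z
  rw [Algebra.traceForm_apply, ← Finset.sum_range_reflect, Finset.sum_mul, map_sum, ← hy x,
    Finset.mul_sum, map_sum]
  refine Finset.sum_congr rfl fun j hj => ?_
  rw [Finset.mem_range] at hj
  rw [← trace_pow_card_pow (K := K) (y * (a j * x ^ Fintype.card K ^ j)) (d - j)]
  have h1 : d - (d + 1 - 1 - j) = j := by omega
  have h2 : d + 1 - 1 - j = d - j := by omega
  have h3 : Fintype.card K ^ d = Fintype.card K ^ j * Fintype.card K ^ (d - j) := by
    rw [← pow_add]
    congr 1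
    omega
  rw [h1, h2, h3, mul_pow, mul_pow, ← pow_mul x]
  congr 1
  ring

/-- The minimum distance bound: a nonzero linear form takes on `V_{A,h}` values that span a
`K`-space of dimension at least `n - h`. Otherwise the adjoints of its components, which have
`q`-degree at most `h + 1`, share at least `h + 1` dimensions of zeros and are hence proportional;
the coefficients `v_{h,i}` then give an eigenvector of the cyclic system. -/
theorem finrank_le_of_forms_mem {m h : ℕ} (hh : 0 < h) {A : Fin m → F}
    (hA : A ∈ admissibleTuples K m)
    {v : Fin (h + 1) × Fin m → F} (hv : v ≠ 0) (R : Submodule K F)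
    (hR : ∀ x, v ⬝ᵥ familyMap K A h x ∈ R) : finrank K F ≤ finrank K R + h := by
  by_contra! hlt
  have hA0 := hA.1
  set D : Submodule K F := (Algebra.traceForm K F).orthogonal R with hDdef
  have hD : h + 1 ≤ finrank K D := by
    rw [hDdef, LinearMap.BilinForm.finrank_orthogonal (traceForm_nondegenerate K F)]
    omega
  set a : Fin m → ℕ → F := fun i j => formCoeff A v i j with ha
  have hadj : ∀ i, ∀ y ∈ D, ∑ s ∈ Finset.range (h + 2),
      a i (h + 1 - s) ^ Fintype.card K ^ s * y ^ Fintype.card K ^ s = 0 := by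
    intro i y hy
    refine adjoint_vanishes (K := K) (d := h + 1) fun x => ?_
    rw [← dotProduct_familyMap_single]
    have := hy _ (hR (Pi.single i x))
    rwa [Algebra.traceForm_apply, mul_comm] at this
  have hvanish : ∀ i, a i 0 = 0 → ∀ j, j ≤ h + 1 → a i j = 0 := by
    intro i hi j hj
    obtain rfl | hj0 := Nat.eq_zero_or_pos j
    · exact hi
    have := coeff_eq_zero_of_vanishing (d := h + 1)
      (c := fun s => a i (h + 1 - s) ^ Fintype.card K ^ s) D hD (fun y hy => ?_)
      (j := h + 1 - j) (by omega)
    · rw [show h + 1 - (h + 1 - j) = j by omega] at this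
      exact eq_zero_of_pow_eq_zero this
    · have h1 := hadj i y hy
      rw [Finset.sum_range_succ, Nat.sub_self, hi,
        zero_pow (pow_ne_zero _ Fintype.card_ne_zero), zero_mul, add_zero] at h1
      exact h1
  -- a component whose adjoint is nonzero
  obtain ⟨i₀, hi₀⟩ : ∃ i₀, a i₀ 0 ≠ 0 := by
    by_contra! hall
    apply hv
    funext ⟨s, i⟩
    have := hvanish i (hall i) s (by omega)
    simp only [ha, formCoeff, dif_pos s.2] at this
    exact this
  set μ : Fin m → F := fun i => (a i 0 / a i₀ 0) ^ Fintype.card K ^ (h + 1) with hμ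
  have hprop : ∀ i s, s < h + 1 → a i (h + 1 - s) ^ Fintype.card K ^ s =
      μ i * a i₀ (h + 1 - s) ^ Fintype.card K ^ s := by
    intro i s hs
    have := coeff_eq_zero_of_vanishing (d := h + 1)
      (c := fun s => a i (h + 1 - s) ^ Fintype.card K ^ s -
        μ i * a i₀ (h + 1 - s) ^ Fintype.card K ^ s) D hD (fun y hy => ?_) hs
    · exact sub_eq_zero.1 this
    · have h1 := hadj i y hy
      have h2 := hadj i₀ y hy
      rw [Finset.sum_range_succ, Nat.sub_self] at h1 h2
      have h3 : a i 0 ^ Fintype.card K ^ (h + 1) = μ i * a i₀ 0 ^ Fintype.card K ^ (h + 1) := by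
        rw [hμ]
        simp only
        rw [← mul_pow, div_mul_cancel₀ _ hi₀]
      rw [h3] at h1
      simp only [sub_mul, Finset.sum_sub_distrib, mul_assoc, ← Finset.mul_sum]
      linear_combination h1 - μ i * h2
  have hq0 : Fintype.card K ≠ 0 := Fintype.card_ne_zero
  -- the coefficients of the two lowest terms of the adjoints
  have hlow : ∀ i, A i * v (Fin.last h, (finRotate m).symm i) = μ i * a i₀ (h + 1) := by
    intro i
    have := hprop i 0 (by omega)
    rw [pow_zero, pow_one, pow_one, Nat.sub_zero] at this
    rwa [← formCoeff_top]
  have hC0 : a i₀ (h + 1) ≠ 0 := by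
    intro h0
    have hvl : ∀ i, v (Fin.last h, i) = 0 := by
      intro i
      have := hlow (finRotate m i)
      rw [h0, mul_zero, Equiv.symm_apply_apply] at this
      exact (mul_eq_zero.1 this).resolve_left (hA0 _)
    -- the adjoint is the `q`-th power of a `q`-polynomial of `q`-degree at most `h`
    have := coeff_eq_zero_of_vanishing (d := h + 1)
      (c := fun s => a i₀ (h - s) ^ Fintype.card K ^ s) D hD (fun y hy => ?_)
      (j := h) (by omega)
    · rw [Nat.sub_self] at this
      exact hi₀ (eq_zero_of_pow_eq_zero this)
    · have h1 := hadj i₀ y hy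
      rw [Finset.sum_range_succ'] at h1
      rw [Nat.sub_zero, h0, pow_zero, pow_one, zero_mul, add_zero] at h1
      have h2 : (∑ s ∈ Finset.range (h + 1), a i₀ (h - s) ^ Fintype.card K ^ s *
          y ^ Fintype.card K ^ s) ^ Fintype.card K ^ 1 = 0 := by
        rw [sum_pow_card_pow, ← h1]
        refine Finset.sum_congr rfl fun s _ => ?_
        rw [mul_pow, ← pow_mul, ← pow_mul, ← pow_add, Nat.add_sub_add_right]
      exact eq_zero_of_pow_eq_zero h2
  have hnext : ∀ i, v (Fin.last h, i) ^ Fintype.card K =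
      μ i * v (Fin.last h, i₀) ^ Fintype.card K := by
    intro i
    have := hprop i 1 (by omega)
    simpa [ha, formCoeff_last] using this
  have hC1 : v (Fin.last h, i₀) ≠ 0 := by
    intro h0
    have hvl : ∀ i, v (Fin.last h, i) = 0 := by
      intro i
      have := hnext i
      rw [h0, zero_pow hq0, mul_zero] at this
      exact eq_zero_of_pow_eq_zero this
    have := hlow i₀
    rw [hvl, mul_zero] at this
    apply hC0
    rw [ha]
    simp only
    rw [formCoeff_top, hvl, mul_zero]
  refine no_cyclic_eigenvector hA (w := fun i => (v (Fin.last h, i))⁻¹)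
    (fun hw => hC1 (inv_eq_zero.1 (congrFun hw i₀)))
    (a i₀ (h + 1) / v (Fin.last h, i₀) ^ Fintype.card K) fun i => ?_
  have h1 := hlow (finRotate m i)
  have h2 := hnext (finRotate m i)
  rw [Equiv.symm_apply_apply] at h1
  have h3 : A (finRotate m i) * v (Fin.last h, i) * v (Fin.last h, i₀) ^ Fintype.card K =
      a i₀ (h + 1) * v (Fin.last h, finRotate m i) ^ Fintype.card K := by
    rw [h1, h2]
    ring
  -- both sides of the eigenvector equation are zero as soon as one of the inverted entries is
  by_cases h4 : v (Fin.last h, i) = 0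
  · have h5 : v (Fin.last h, finRotate m i) = 0 := by
      rw [h4, mul_zero, zero_mul] at h3
      exact eq_zero_of_pow_eq_zero ((mul_eq_zero.1 h3.symm).resolve_left hC0)
    simp only [h4, h5, inv_zero, zero_pow hq0, mul_zero]
  · have h5 : v (Fin.last h, finRotate m i) ≠ 0 := by
      intro h5
      rw [h5, zero_pow hq0, mul_zero] at h3
      exact mul_ne_zero (mul_ne_zero (hA0 _) h4) (pow_ne_zero _ hC1) h3
    rw [inv_pow]
    field_simp
    linear_combination h3

end Distance

/-! ### Endomorphisms of `V_{A,h}` -/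

section Endomorphisms

variable {K F : Type*} [Field K] [Fintype K] [Field F] [Finite F] [Algebra K F]

/-- If the `K`-linear map `φ` on parameters is induced by the `F`-linear endomorphism `M` of the
ambient space, then `φ` is `F`-linear, provided that `h + 3 ≤ n`. The coordinates of `φ x` are
linear forms in the coordinates of the point with parameter `x`, and so are their `q^s`-th powers
for `s < h`; comparing the two highest coefficients leaves only the terms of `q`-degree zero. -/
theorem induced_eq_mul {m h : ℕ} (h2 : 2 ≤ h) (hn : h + 3 ≤ finrank K F) {A : Fin m → F}
    (hA : ∀ i, A i ≠ 0) (M : Matrix (Fin (h + 1) × Fin m) (Fin (h + 1) × Fin m) F)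
    {φ : (Fin m → F) → Fin m → F}
    (hφ : ∀ x, familyMap K A h (φ x) = M.mulVec (familyMap K A h x)) (i i' : Fin m) (x : F) :
    φ (Pi.single i' x) i = M (0, i) (0, i') * x := by
  have hrow : ∀ (s : ℕ) (hs : s < h) (i i' : Fin m) (x : F),
      ∑ j ∈ Finset.range (h + 2), formCoeff A (M (⟨s, by omega⟩, i)) i' j * x ^ Fintype.card K ^ j =
        φ (Pi.single i' x) i ^ Fintype.card K ^ s := by
    intro s hs i i' x
    rw [← dotProduct_familyMap_single]
    have := congrFun (hφ (Pi.single i' x)) (⟨s, by omega⟩, i)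
    rw [Matrix.mulVec] at this
    rw [← this]
    simp [familyMap, hs]
  have hφ0 : ∀ (i i' : Fin m) (x : F), φ (Pi.single i' x) i =
      ∑ j ∈ Finset.range (h + 2), formCoeff A (M (0, i)) i' j * x ^ Fintype.card K ^ j := by
    intro i i' x
    have := hrow 0 (by omega) i i' x
    rw [pow_zero, pow_one] at this
    exact this.symm
  have hkill : ∀ p : Fin (h + 1) × Fin m, (∀ i', formCoeff A (M p) i' (h + 1) = 0) →
      ∀ i', formCoeff A (M p) i' h = 0 := by
    intro p hp i'
    have := hp (finRotate m i')
    rw [formCoeff_top, Equiv.symm_apply_apply] at this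
    rw [formCoeff_last]
    exact (mul_eq_zero.1 this).resolve_left (hA _)
  have hstep : ∀ t, t < h → ∀ (i i' : Fin m) (j : ℕ), h - t ≤ j → j < h + 2 →
      formCoeff A (M (0, i)) i' j = 0 := by
    intro t
    induction t with
    | zero =>
      intro _ i i' j hj hj'
      have htop : ∀ i', formCoeff A (M (0, i)) i' (h + 1) = 0 := by
        intro i'
        have := coeff_eq_of_eq_pow (K := K) (a := h + 2) (b := h + 2) (s := 1)
          (c := formCoeff A (M (⟨1, by omega⟩, i)) i') (d := formCoeff A (M (0, i)) i')
          (by omega) (by omega) (fun x => by rw [hrow 1 (by omega), hφ0]) (k := h + 2) (by omega)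
        rw [if_neg (lt_irrefl _), if_pos (by omega)] at this
        exact eq_zero_of_pow_eq_zero this.symm
      obtain rfl | rfl : j = h ∨ j = h + 1 := by omega
      · exact hkill _ htop i'
      · exact htop i'
    | succ t ih =>
      intro ht i i' j hj hj'
      rcases Nat.lt_or_ge j (h - t) with hlt | hge
      swap
      · exact ih (by omega) i i' j hge hj'
      obtain rfl : j = h - (t + 1) := by omega
      -- the `q^(t+1)`-th power of `φ x` has `q`-degree at most `h`
      have hcmp : ∀ i' k, k < finrank K F → _ := fun i' k hk =>
        coeff_eq_of_eq_pow (K := K) (a := h + 2) (b := h - t) (s := t + 1)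
          (c := formCoeff A (M (⟨t + 1, by omega⟩, i)) i') (d := formCoeff A (M (0, i)) i')
          (by omega) (by omega) (fun x => by
            rw [hrow (t + 1) ht, hφ0]
            congr 1
            symm
            apply Finset.sum_subset (Finset.range_mono (by omega))
            intro j hj hj'
            rw [Finset.mem_range] at hj hj'
            rw [ih (by omega) i i' j (by omega) hj, zero_mul]) (k := k) hk
      have htop : ∀ i', formCoeff A (M (⟨t + 1, by omega⟩, i)) i' (h + 1) = 0 := by
        intro i'
        have := hcmp i' (h + 1) (by omega)
        rwa [if_pos (by omega), if_neg (by omega)] at this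
      have := hcmp i' h (by omega)
      rw [if_pos (by omega), if_pos (by omega), hkill _ htop i'] at this
      exact eq_zero_of_pow_eq_zero this.symm
  rw [hφ0, Finset.sum_eq_single 0]
  · rw [pow_zero, pow_one, formCoeff, dif_pos (by omega)]
    rfl
  · intro j hj hj0
    rw [hstep (h - 1) (by omega) i i' j (by omega) (Finset.mem_range.1 hj), zero_mul]
  · intro h0
    exact absurd (Finset.mem_range.2 (by omega)) h0

/-- The matrix of an induced endomorphism commutes, up to a power of the Frobenius map, with the
semilinear map `x ↦ (α_{i+1} x_{i+1}^q)_i`. -/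
theorem induced_commutes {m h : ℕ} (h2 : 2 ≤ h) (hn : h + 3 ≤ finrank K F) {A : Fin m → F}
    (hA : ∀ i, A i ≠ 0) (M : Matrix (Fin (h + 1) × Fin m) (Fin (h + 1) × Fin m) F)
    {φ : (Fin m → F) → Fin m → F}
    (hφ : ∀ x, familyMap K A h (φ x) = M.mulVec (familyMap K A h x)) (i i' : Fin m) :
    A (finRotate m i) * M (0, finRotate m i) (0, finRotate m i') ^ Fintype.card K ^ (h + 1) =
      A (finRotate m i') * M (0, i) (0, i') ^ Fintype.card K ^ h := by
  have hcmp : ∀ i' k, k < h + 2 → _ := fun i' k hk =>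
    coeff_eq_zero_of_vanishing (K := K) (F := F) (d := h + 2)
      (c := fun k => formCoeff A (M (Fin.last h, i)) i' k -
        ((if k = h then M (0, i) (0, i') ^ Fintype.card K ^ h else 0) +
        (if k = h + 1 then A (finRotate m i) *
          M (0, finRotate m i) (0, i') ^ Fintype.card K ^ (h + 1) else 0))) ⊤
      (by rw [finrank_top]; omega) (fun x _ => by
        simp only [sub_mul, add_mul, Finset.sum_sub_distrib, Finset.sum_add_distrib, ite_mul,
          zero_mul, Finset.sum_ite_eq', Finset.mem_range]
        rw [← dotProduct_familyMap_single, if_pos (by omega), if_pos (by omega)]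
        have := congrFun (hφ (Pi.single i' x)) (Fin.last h, i)
        rw [Matrix.mulVec] at this
        rw [← this]
        simp only [familyMap, LinearMap.coe_mk, AddHom.coe_mk, Fin.val_last, lt_irrefl, if_false]
        rw [induced_eq_mul h2 hn hA M hφ, induced_eq_mul h2 hn hA M hφ]
        ring) (j := k) hk
  have h1 := hcmp i' h (by omega)
  have h3 := hcmp (finRotate m i') (h + 1) (by omega)
  rw [if_pos rfl, if_neg (by omega), add_zero, formCoeff_last, sub_eq_zero] at h1
  rw [if_neg (by omega), if_pos rfl, zero_add, formCoeff_top, Equiv.symm_apply_apply,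
    sub_eq_zero] at h3
  rw [← h1, ← h3]

/-- An `F`-linear map that preserves `V_{A,h}` maps it onto a `K`-space whose dimension is a
multiple of `n` but not `n` itself: the image is parametrized by an `F`-subspace of `F^m` that is
invariant under the semilinear map `x ↦ (α_{i+1} x_{i+1}^q)_i`, and a line cannot be invariant. -/
theorem finrank_map_of_invariant {m h : ℕ} (h2 : 2 ≤ h) (hn : h + 3 ≤ finrank K F)
    {A : Fin m → F} (hA : A ∈ admissibleTuples K m)
    (P : (Fin (h + 1) × Fin m → F) →ₗ[F] (Fin (h + 1) × Fin m → F))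
    (hP : ∀ w ∈ familySubspace K A h, P w ∈ familySubspace K A h) :
    finrank K F ∣ finrank K ((familySubspace K A h).map (P.restrictScalars K)) ∧
      finrank K ((familySubspace K A h).map (P.restrictScalars K)) ≠ finrank K F := by
  have hA0 := hA.1
  set M := LinearMap.toMatrix' P with hM
  have hMP : ∀ w, M.mulVec w = P w := fun w => by rw [hM, LinearMap.toMatrix'_mulVec]
  have hex : ∀ x, ∃ y, familyMap K A h y = M.mulVec (familyMap K A h x) := by
    intro x
    rw [hMP]
    exact hP _ ⟨x, rfl⟩
  choose φ hφ using hex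
  set B : Matrix (Fin m) (Fin m) F := Matrix.of fun i i' => M (0, i) (0, i') with hB
  have hφB : ∀ x, φ x = B.mulVec x := by
    intro x
    funext i
    have h0 : ∀ x, φ x i = M (0, i) ⬝ᵥ familyMap K A h x := by
      intro x
      have := congrFun (hφ x) (0, i)
      rwa [familyMap_apply_zero (by omega)] at this
    rw [h0, dotProduct_familyMap, Matrix.mulVec, dotProduct]
    refine Finset.sum_congr rfl fun i' _ => ?_
    rw [← h0, induced_eq_mul h2 hn hA0 M hφ]
    rfl
  set E : Submodule F (Fin m → F) := LinearMap.range B.mulVecLin with hE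
  have hmap : (familySubspace K A h).map (P.restrictScalars K) =
      (E.restrictScalars K).map (familyMap K A h) := by
    ext w
    constructor
    · rintro ⟨_, ⟨x, rfl⟩, rfl⟩
      refine ⟨φ x, ⟨x, by rw [Matrix.mulVecLin_apply, hφB]⟩, ?_⟩
      rw [hφ, hMP]
      rfl
    · rintro ⟨_, ⟨x, rfl⟩, rfl⟩
      refine ⟨familyMap K A h x, ⟨x, rfl⟩, ?_⟩
      rw [Matrix.mulVecLin_apply, ← hφB, hφ, hMP]
      rfl
  have hfin : finrank K ((familySubspace K A h).map (P.restrictScalars K)) =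
      finrank K F * finrank F E := by
    rw [hmap,
      (Submodule.equivMapOfInjective _ (familyMap_injective (by omega) A) _).symm.finrank_eq,
      Module.finrank_mul_finrank K F E]
    rfl
  rw [hfin]
  refine ⟨Dvd.intro _ rfl, fun hone => ?_⟩
  have hE1 : finrank F E = 1 := Nat.eq_of_mul_eq_mul_left (by omega) (hone.trans (mul_one _).symm)
  obtain ⟨e, he0, he⟩ := finrank_eq_one_iff'.1 hE1
  have hg : ∀ i', ∃ c : F, ∀ i, B i i' = c * (e : Fin m → F) i := by
    intro i'
    obtain ⟨c, hc⟩ := he ⟨B.mulVecLin (Pi.single i' 1), ⟨_, rfl⟩⟩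
    refine ⟨c, fun i => ?_⟩
    have := congrFun (congrArg Subtype.val hc) i
    simpa using this.symm
  choose g hg using hg
  obtain ⟨i₀, hi₀⟩ : ∃ i₀, g i₀ ≠ 0 := by
    by_contra! h0
    apply he0
    have : B = 0 := by
      ext i i'
      rw [hg, h0, zero_mul, Matrix.zero_apply]
    obtain ⟨e, x, rfl⟩ := e
    ext1
    simp [this]
  obtain ⟨i₁, rfl⟩ := (finRotate m).surjective i₀
  have he0' : (e : Fin m → F) ≠ 0 := fun h0 => he0 (Subtype.ext h0)
  refine no_cyclic_eigenvector hA (w := fun i => (e : Fin m → F) i ^ Fintype.card K ^ h)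
    (fun h0 => he0' (funext fun i => eq_zero_of_pow_eq_zero (congrFun h0 i)))
    (A (finRotate m i₁) * g i₁ ^ Fintype.card K ^ h /
      g (finRotate m i₁) ^ Fintype.card K ^ (h + 1)) fun i => ?_
  have hc := induced_commutes h2 hn hA0 M hφ i i₁
  have hBM : ∀ i i', M (0, i) (0, i') = g i' * (e : Fin m → F) i := fun i i' => hg i' i
  rw [hBM, hBM, mul_pow, mul_pow] at hc
  have hne : g (finRotate m i₁) ^ Fintype.card K ^ (h + 1) ≠ 0 := pow_ne_zero _ hi₀
  rw [← pow_mul, ← pow_succ, div_mul_eq_mul_div, eq_div_iff hne]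
  linear_combination hc

end Endomorphisms

/-! ### Codes and `q`-systems -/

section CodesAndSystems

variable {K F : Type*} [Field K] [Field F] [Algebra K F]

/-- The encoder of the code given by the vectors `u j`: it sends a linear form to its values. -/
def evalForms {ι : Type*} [Fintype ι] {t : ℕ} (u : Fin t → ι → F) : (ι → F) →ₗ[F] (Fin t → F) where
  toFun v j := v ⬝ᵥ u j
  map_add' v w := funext fun j => add_dotProduct v w (u j)
  map_smul' c v := funext fun j => smul_dotProduct c v (u j)

/-- The values of a linear form, as a `K`-linear map. -/
def formValue (K : Type*) {F : Type*} [Field K] [Field F] [Algebra K F] {ι : Type*} [Fintype ι]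
    (v : ι → F) : (ι → F) →ₗ[K] F where
  toFun w := v ⬝ᵥ w
  map_add' := dotProduct_add v
  map_smul' c w := dotProduct_smul c v w

theorem span_eq_top_iff_forms {ι : Type*} [Fintype ι] {U : Submodule K (ι → F)} :
    Submodule.span F (U : Set (ι → F)) = ⊤ ↔
      ∀ v : ι → F, (∀ w ∈ U, v ⬝ᵥ w = 0) → v = 0 := by
  classical
  constructor
  · intro hU v hv
    have hle : Submodule.span F (U : Set (ι → F)) ≤ LinearMap.ker (formValue F v) :=
      Submodule.span_le.2 fun w hw => hv w hw
    rw [hU] at hle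
    funext i
    have : v ⬝ᵥ (Pi.single i 1 : ι → F) = 0 := hle Submodule.mem_top
    simpa using this
  · intro hv
    by_contra hne
    obtain ⟨f, hf0, hf⟩ := Submodule.exists_le_ker_of_lt_top _ (lt_top_iff_ne_top.2 hne)
    apply hf0
    have hfv : ∀ w, f w = (fun i => f (Pi.single i 1)) ⬝ᵥ w := by
      intro w
      conv_lhs => rw [← Finset.univ_sum_single w, map_sum]
      refine Finset.sum_congr rfl fun i _ => ?_
      rw [show Pi.single i (w i) = w i • (Pi.single i 1 : ι → F) by
        rw [← Pi.single_smul, smul_eq_mul, mul_one], map_smul, smul_eq_mul, mul_comm]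
    have h0 := hv _ fun w hw => by
      rw [← hfv]
      exact hf (Submodule.subset_span hw)
    refine LinearMap.ext fun w => ?_
    rw [hfv w, h0, zero_dotProduct, LinearMap.zero_apply]

theorem span_basis_eq {ι : Type*} {t : ℕ} {U : Submodule K (ι → F)} (u : Basis (Fin t) K U) :
    Submodule.span K (Set.range fun j => (u j : ι → F)) = U := by
  have := congrArg (Submodule.map U.subtype) u.span_eq
  rw [Submodule.map_span, Submodule.map_top, Submodule.range_subtype, ← Set.range_comp] at this
  exact this

theorem rankWeight_evalForms {ι : Type*} [Fintype ι] {t : ℕ} {U : Submodule K (ι → F)}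
    (u : Basis (Fin t) K U) (v : ι → F) :
    rankWeight K (evalForms (fun j => (u j : ι → F)) v) = finrank K (U.map (formValue K v)) := by
  rw [rankWeight]
  conv_rhs => rw [← span_basis_eq u]
  rw [Submodule.map_span, ← Set.range_comp]
  rfl

theorem evalForms_injective {ι : Type*} [Fintype ι] {t : ℕ} {U : Submodule K (ι → F)}
    (hU : Submodule.span F (U : Set (ι → F)) = ⊤) (u : Basis (Fin t) K U) :
    Function.Injective (evalForms fun j => (u j : ι → F)) := by
  rw [← LinearMap.ker_eq_bot, LinearMap.ker_eq_bot']
  intro v hv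
  refine span_eq_top_iff_forms.1 hU v fun w hw => ?_
  have hle : U ≤ LinearMap.ker (formValue K v) := by
    rw [← span_basis_eq u, Submodule.span_le]
    rintro _ ⟨j, rfl⟩
    exact congrFun hv j
  exact hle hw

theorem eq_range_evalForms {ι : Type*} [Fintype ι] {t : ℕ} {C : Submodule F (Fin t → F)}
    {u : Fin t → ι → F} (h : ∀ c, c ∈ C ↔ ∃ v : ι → F, c = fun j => v ⬝ᵥ u j) :
    C = LinearMap.range (evalForms u) := by
  ext c
  rw [h]
  exact exists_congr fun v => eq_comm

/-- Equivalence of associated codes lifts to the `q`-systems: an `F`-linear isomorphism of the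
ambient spaces carries one `q`-system to the other. -/
theorem exists_equiv_of_codeEquivalent {ι ι' : Type*} [Fintype ι] [Fintype ι'] {t : ℕ}
    {C C' : Submodule F (Fin t → F)} {U : Submodule K (ι → F)} {U' : Submodule K (ι' → F)}
    (hC : IsAssociatedCode K C U) (hC' : IsAssociatedCode K C' U') (hCC' : CodeEquivalent K C C') :
    ∃ Φ : (ι → F) ≃ₗ[F] (ι' → F), U.map (Φ.toLinearMap.restrictScalars K) = U' := by
  classical
  obtain ⟨hU, u, hu⟩ := hC
  obtain ⟨hU', u', hu'⟩ := hC'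
  obtain ⟨M, a, hMa⟩ := hCC'
  set M₀ : Matrix (Fin t) (Fin t) K := (M : Matrix (Fin t) (Fin t) K) with hM₀
  -- the two ambient dimensions agree
  have hcard : Fintype.card ι = Fintype.card ι' := by
    have h1 : finrank F C = Fintype.card ι := by
      rw [eq_range_evalForms hu, LinearMap.finrank_range_of_inj (evalForms_injective hU u)]
      simp
    have h2 : finrank F C' = Fintype.card ι' := by
      rw [eq_range_evalForms hu', LinearMap.finrank_range_of_inj (evalForms_injective hU' u')]
      simp
    have hinj : Function.Injective ((M₀.map (algebraMap K F)).vecMulLinear) := by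
      rw [Matrix.coe_vecMulLinear]
      apply Matrix.vecMul_injective_of_isUnit
      exact M.isUnit.map (algebraMap K F).mapMatrix
    have h3 : C' = C.map (M₀.map (algebraMap K F)).vecMulLinear := by
      ext w
      rw [hMa, Submodule.mem_map]
      constructor
      · rintro ⟨v, hv, rfl⟩
        exact ⟨(a : F) • v, C.smul_mem _ hv, by simp⟩
      · rintro ⟨v, hv, rfl⟩
        exact ⟨(a⁻¹ : Fˣ) • v, C.smul_mem _ hv, by
          simp [Matrix.smul_vecMul, Units.smul_def, smul_smul]⟩
    rw [← h1, ← h2, h3, (Submodule.equivMapOfInjective _ hinj C).symm.finrank_eq]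
  -- the coordinate forms of the second system, pulled back to the first one
  have hrow : ∀ p : ι', ∃ w : ι → F, ∀ j,
      (u' j : ι' → F) p = a * ∑ l, (w ⬝ᵥ (u l : ι → F)) * algebraMap K F (M₀ l j) := by
    intro p
    have h1 : (fun j => Pi.single p 1 ⬝ᵥ (u' j : ι' → F)) ∈ C' := (hu' _).2 ⟨_, rfl⟩
    obtain ⟨v, hv, hw⟩ := (hMa _).1 h1
    obtain ⟨w, rfl⟩ := (hu v).1 hv
    refine ⟨w, fun j => ?_⟩
    have := congrFun hw j
    rwa [single_one_dotProduct] at this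
  choose w hw using hrow
  set Ψ : (ι → F) →ₗ[F] (ι' → F) := (a : F) • (Matrix.of w).mulVecLin with hΨ
  have hΨu : ∀ j, Ψ (∑ l, M₀ l j • (u l : ι → F)) = u' j := by
    intro j
    funext p
    rw [hw, hΨ, LinearMap.smul_apply, Pi.smul_apply, smul_eq_mul, Matrix.mulVecLin_apply,
      Matrix.mulVec, dotProduct_sum]
    congr 1
    refine Finset.sum_congr rfl fun l _ => ?_
    rw [dotProduct_smul, Algebra.smul_def, mul_comm]
    rfl
  -- the transition matrix is invertible, so the combinations of the `u l` span `U`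
  have hmap : U.map (Ψ.restrictScalars K) = U' := by
    apply le_antisymm
    · conv_lhs => rw [← span_basis_eq u]
      rw [Submodule.map_span, Submodule.span_le]
      rintro _ ⟨_, ⟨l, rfl⟩, rfl⟩
      have h1 : (u l : ι → F) =
          ∑ j, (M⁻¹ : GL (Fin t) K).1 j l • ∑ l', M₀ l' j • (u l' : ι → F) := by
        simp only [Finset.smul_sum, smul_smul]
        rw [Finset.sum_comm]
        simp only [← Finset.sum_smul]
        have h2 : ∀ l', ∑ j, (M⁻¹ : GL (Fin t) K).1 j l * M₀ l' j = if l' = l then 1 else 0 := by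
          intro l'
          have h3 : M₀ * (M⁻¹ : GL (Fin t) K).1 = 1 := Units.mul_inv M
          have := congrFun (congrFun h3 l') l
          rw [Matrix.mul_apply, Matrix.one_apply] at this
          rw [← this]
          exact Finset.sum_congr rfl fun j _ => mul_comm _ _
        simp only [h2, ite_smul, one_smul, zero_smul, Finset.sum_ite_eq', Finset.mem_univ, if_true]
      simp only [SetLike.mem_coe]
      rw [h1, map_sum]
      refine U'.sum_mem fun j _ => ?_
      rw [map_smul]
      refine U'.smul_mem _ ?_
      rw [LinearMap.restrictScalars_apply, hΨu]
      exact (u' j).2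
    · conv_lhs => rw [← span_basis_eq u']
      rw [Submodule.span_le]
      rintro _ ⟨j, rfl⟩
      exact ⟨_, U.sum_mem fun l _ => U.smul_mem _ (u l).2, hΨu j⟩
  have hsurj : Function.Surjective Ψ := by
    rw [← LinearMap.range_eq_top, eq_top_iff, ← hU', Submodule.span_le, ← hmap]
    rintro _ ⟨x, _, rfl⟩
    exact ⟨x, rfl⟩
  have hinj : Function.Injective Ψ :=
    (LinearMap.injective_iff_surjective_of_finrank_eq_finrank (by simp [hcard])).2 hsurj
  exact ⟨LinearEquiv.ofBijective Ψ ⟨hinj, hsurj⟩, hmap⟩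

/-- A form of the Singleton bound: over an extension of degree `n`, a space of linear forms of
dimension greater than `t s / n` contains a nonzero form whose values at `t` given vectors span at
most `n - s` dimensions. -/
theorem exists_form_finrank_le [FiniteDimensional K F] {ι : Type*} [Fintype ι] {t s : ℕ}
    (hs : s ≤ finrank K F) (hlt : t * s < finrank K F * Fintype.card ι)
    {U : Submodule K (ι → F)} (u : Basis (Fin t) K U) :
    ∃ v : ι → F, v ≠ 0 ∧ finrank K (U.map (formValue K v)) ≤ finrank K F - s := by
  obtain ⟨W, hW⟩ : ∃ W : Submodule K F, finrank K W = finrank K F - s := by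
    obtain ⟨f, hf⟩ := exists_linearIndependent_of_le_finrank (Nat.sub_le (finrank K F) s)
    exact ⟨Submodule.span K (Set.range f), by rw [finrank_span_eq_card hf, Fintype.card_fin]⟩
  set L : (ι → F) →ₗ[K] (Fin t → F ⧸ W) :=
    LinearMap.pi fun j => W.mkQ ∘ₗ LinearMap.proj j ∘ₗ
      (evalForms fun j => (u j : ι → F)).restrictScalars K with hL
  have hker : LinearMap.ker L ≠ ⊥ := by
    apply LinearMap.ker_ne_bot_of_finrank_lt
    have := W.finrank_quotient_add_finrank
    rw [Module.finrank_pi_fintype, Module.finrank_pi_fintype]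
    simp only [Finset.sum_const, Finset.card_univ, Fintype.card_fin, smul_eq_mul]
    rw [show finrank K (F ⧸ W) = s by omega, mul_comm (Fintype.card ι)]
    exact hlt
  obtain ⟨v, hv, hv0⟩ := Submodule.exists_mem_ne_zero_of_ne_bot hker
  refine ⟨v, hv0, ?_⟩
  rw [← hW]
  apply Submodule.finrank_mono
  conv_lhs => rw [← span_basis_eq u]
  rw [Submodule.map_span, Submodule.span_le]
  rintro _ ⟨_, ⟨j, rfl⟩, rfl⟩
  have := congrFun (LinearMap.mem_ker.1 hv) j
  exact (Submodule.Quotient.mk_eq_zero W).1 this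

end CodesAndSystems

/-! ### Decompositions of `q`-systems -/

section Decompositions

variable {K F V : Type*} [Field K] [Field F] [Algebra K F]
  [AddCommGroup V] [Module K V] [Module F V] [IsScalarTower K F V]

/-- A direct sum of maximum `h`-scattered subspaces is preserved by the projection onto each of the
summands, and the dimension of the image is determined by that of the summand. -/
theorem exists_projection_of_isDirectSum [Nontrivial V] {h : ℕ} {D : Set ℕ} {U : Submodule K V}
    (hU : IsDirectSumOfMaxScattered F h D U) :
    ∃ d ∈ D, ∃ P : V →ₗ[F] V, (∀ w ∈ U, P w ∈ U) ∧
      (h + 1) * finrank K (U.map (P.restrictScalars K)) = d * finrank K F := by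
  obtain ⟨s, W, S, hW, hWS, rfl⟩ := hU
  obtain ⟨hind, htop⟩ := (DirectSum.isInternal_submodule_iff_iSupIndep_and_iSup_eq_top W).1 hW
  have hs : Nonempty (Fin s) := by
    by_contra hs
    rw [not_nonempty_iff] at hs
    rw [iSup_of_empty] at htop
    exact bot_ne_top htop
  obtain ⟨j⟩ := hs
  have hcompl : IsCompl (W j) (⨆ i, ⨆ (_ : i ≠ j), W i) := by
    refine ⟨hind j, codisjoint_iff.2 ?_⟩
    rw [← htop]
    apply le_antisymm
    · exact sup_le (le_iSup W j) (iSup₂_le fun i _ => le_iSup W i)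
    · refine iSup_le fun i => ?_
      by_cases hij : i = j
      · exact hij ▸ le_sup_left
      · exact le_sup_of_le_right (le_iSup₂_of_le i hij le_rfl)
  have hSW : ∀ i, ∀ x ∈ S i, x ∈ W i := fun i x hx => by
    rw [← (hWS i).2.1.2.2.1]
    exact Submodule.subset_span hx
  set P := (W j).projection _ hcompl with hP
  have hmap : (⨆ i, S i).map (P.restrictScalars K) = S j := by
    rw [Submodule.map_iSup]
    apply le_antisymm
    · refine iSup_le fun i => ?_
      rintro _ ⟨x, hx, rfl⟩
      by_cases hij : i = j
      · subst hij
        rw [LinearMap.restrictScalars_apply, hP,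
          Submodule.projection_apply_of_mem_left hcompl (hSW i x hx)]
        exact hx
      · rw [LinearMap.restrictScalars_apply, hP, Submodule.projection_apply_of_mem_right hcompl
          (Submodule.mem_iSup_of_mem i (Submodule.mem_iSup_of_mem hij (hSW i x hx)))]
        exact (S j).zero_mem
    · refine le_iSup_of_le j fun x hx => ⟨x, hx, ?_⟩
      rw [LinearMap.restrictScalars_apply, hP,
        Submodule.projection_apply_of_mem_left hcompl (hSW j x hx)]
  refine ⟨_, (hWS j).1, P, fun w hw => ?_, ?_⟩
  · have : P w ∈ (⨆ i, S i).map (P.restrictScalars K) := ⟨w, hw, rfl⟩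
    rw [hmap] at this
    exact le_iSup S j this
  · rw [hmap]
    exact (hWS j).2.2

end Decompositions

/-! ### The code -/

section Main

variable {K F : Type*} [Field K] [Fintype K] [Field F] [Finite F] [Algebra K F]

theorem span_familySubspace {m h : ℕ} (hh : 0 < h) (hn : h < finrank K F) {A : Fin m → F}
    (hA : A ∈ admissibleTuples K m) :
    Submodule.span F (familySubspace K A h : Set (Fin (h + 1) × Fin m → F)) = ⊤ := by
  rw [span_eq_top_iff_forms]
  intro v hv
  by_contra hv0
  have := finrank_le_of_forms_mem hh hA hv0 ⊥ fun x => (Submodule.mem_bot K).2 (hv _ ⟨x, rfl⟩)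
  rw [finrank_bot] at this
  omega

theorem isMRDCode_of_isAssociatedCode {n m h : ℕ} (hn : finrank K F = n) (hm : 0 < m) (hh : 0 < h)
    (hhn : h < n) {A : Fin m → F} (hA : A ∈ admissibleTuples K m)
    {C : Submodule F (Fin (m * n) → F)} (hC : IsAssociatedCode K C (familySubspace K A h)) :
    IsMRDCode K C (m * (h + 1)) (n - h) := by
  obtain ⟨hU, u, hu⟩ := hC
  have hCr := eq_range_evalForms hu
  have hinj := evalForms_injective hU u
  have hlow : ∀ v, v ≠ 0 → n - h ≤ finrank K ((familySubspace K A h).map (formValue K v)) := by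
    intro v hv
    have := finrank_le_of_forms_mem hh hA hv ((familySubspace K A h).map (formValue K v))
      fun x => ⟨_, ⟨x, rfl⟩, rfl⟩
    omega
  refine ⟨⟨?_, ?_, ?_⟩, ?_⟩
  · rw [hCr, LinearMap.finrank_range_of_inj hinj]
    simp [mul_comm]
  · obtain ⟨v, hv, hle⟩ := exists_form_finrank_le (K := K) (s := h) (by omega) (by
      rw [hn]
      simp only [Fintype.card_prod, Fintype.card_fin]
      have : 0 < m * n := Nat.mul_pos hm (by omega)
      nlinarith) u
    refine ⟨evalForms (fun j => (u j : _ → F)) v, hCr ▸ ⟨v, rfl⟩, fun h0 => hv ?_, ?_⟩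
    · exact hinj (h0.trans (map_zero _).symm)
    · rw [rankWeight_evalForms]
      have := hlow v hv
      omega
  · rintro _ ⟨c, hc, hc0, rfl⟩
    rw [hCr] at hc
    obtain ⟨v, rfl⟩ := hc
    rw [rankWeight_evalForms]
    exact hlow v fun h0 => hc0 (by rw [h0, map_zero])
  · rw [hn, show n + 1 - (n - h) = h + 1 by omega, min_eq_right]
    · ring
    · obtain ⟨e, rfl⟩ := Nat.exists_eq_add_of_lt hhn
      obtain ⟨m, rfl⟩ := Nat.exists_eq_add_of_lt hm
      have h1 : (0 + m + 1) * (h + 1) ≤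
          (0 + m + 1) * (h + e + 1) + 1 - (h + e + 1 - h) := by
        have h2 : m * (h + 1) ≤ m * (h + e + 1) := Nat.mul_le_mul_left _ (by omega)
        simp only [zero_add, add_mul, one_mul] at h2 ⊢
        omega
      calc _ = (h + e + 1) * ((0 + m + 1) * (h + 1)) := by ring
        _ ≤ _ := Nat.mul_le_mul_left _ h1

/-- No `F`-linear isomorphism carries `V_{A,h}` to one of the previously known maximum scattered
subspaces. A summand of a direct sum decomposition would be the image of a projection, of
`K`-dimension `n`, or else `8 = 4 · 6 / 3` with `n = 6`, which is no multiple of `n`. The remaining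
two families are excluded by their dimensions. -/
theorem not_isKnownMaxScattered {m h h' k : ℕ} (hm : 0 < m) (h2 : 2 ≤ h)
    (hn : h + 3 ≤ finrank K F) {A : Fin m → F} (hA : A ∈ admissibleTuples K m)
    (Φ : (Fin (h + 1) × Fin m → F) ≃ₗ[F] (Fin k → F)) :
    ¬ IsKnownMaxScattered F h'
      ((familySubspace K A h).map (Φ.toLinearMap.restrictScalars K)) := by
  set U := familySubspace K A h with hU
  set U' := U.map (Φ.toLinearMap.restrictScalars K) with hU'
  have hk : finrank F (Fin k → F) = m * (h + 1) := by
    rw [← Φ.finrank_eq]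
    simp [mul_comm]
  have hUU' : finrank K U' = m * finrank K F := by
    rw [← finrank_familySubspace (K := K) (by omega : 0 < h) A]
    exact (Submodule.equivMapOfInjective (Φ.toLinearMap.restrictScalars K)
      Φ.injective U).symm.finrank_eq
  have hnt : Nontrivial (Fin k → F) := by
    apply Module.nontrivial_of_finrank_pos (R := F)
    rw [hk]
    positivity
  have hproj : ∀ P : (Fin k → F) →ₗ[F] (Fin k → F), (∀ w ∈ U', P w ∈ U') →
      finrank K F ∣ finrank K (U'.map (P.restrictScalars K)) ∧
        finrank K (U'.map (P.restrictScalars K)) ≠ finrank K F := by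
    intro P hP
    have key := finrank_map_of_invariant h2 hn hA
      (Φ.symm.toLinearMap ∘ₗ P ∘ₗ Φ.toLinearMap) (fun w hw => by
        obtain ⟨w', hw', h1⟩ := hP (Φ w) ⟨w, hw, rfl⟩
        have : Φ.symm (P (Φ w)) = w' := by
          rw [← h1]
          exact Φ.symm_apply_apply w'
        exact this ▸ hw')
    have hmap : U.map ((Φ.symm.toLinearMap ∘ₗ P ∘ₗ Φ.toLinearMap).restrictScalars K) =
        (U'.map (P.restrictScalars K)).map (Φ.symm.toLinearMap.restrictScalars K) := by
      rw [hU', ← Submodule.map_comp, ← Submodule.map_comp]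
      rfl
    rw [← hU, hmap, ← (Submodule.equivMapOfInjective (Φ.symm.toLinearMap.restrictScalars K)
      Φ.symm.injective _).finrank_eq] at key
    exact key
  rintro (hK | ⟨_, _, h3, ⟨r, hr, _, hr2⟩, hK⟩ | ⟨_, h3, _⟩ | ⟨h3, h6, hK⟩)
  · obtain ⟨d, rfl, P, hP, hd⟩ := exists_projection_of_isDirectSum hK
    exact (hproj P hP).2 (Nat.eq_of_mul_eq_mul_left (Nat.succ_pos h') hd)
  · have hd := hK.2
    rw [hUU', finrank_top, hk] at hd
    have hhh : h' + 1 = h + 1 := by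
      have : 0 < m * finrank K F := Nat.mul_pos hm (by omega)
      nlinarith
    rw [hk, show h + 1 = finrank K F - 2 by omega, ← mul_assoc] at hr2
    have := Nat.eq_of_mul_eq_mul_right (by omega) hr2
    rw [← this] at hr
    exact absurd hr (by simp)
  · omega
  · obtain ⟨d, hdD, P, hP, hd⟩ := exists_projection_of_isDirectSum hK
    obtain ⟨⟨c, hc⟩, hne⟩ := hproj P hP
    rw [h6] at hd hc hne
    subst h3
    obtain rfl | rfl : d = 3 ∨ d = 4 := hdD
    · omega
    · omega

end Main

theorem mainTheorem7 {K F : Type*} [Field K] [Fintype K] [Field F] [Finite F] [Algebra K F]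
    (n m h : ℕ) (hn : Module.finrank K F = n) (hm : 3 ≤ m) (h2 : 2 ≤ h) (hhn : h + 3 ≤ n)
    (A : Fin m → F) (hA : A ∈ admissibleTuples K m) :
    (∃ C : Submodule F (Fin (m * n) → F), IsAssociatedCode K C (familySubspace K A h)) ∧
    ∀ C : Submodule F (Fin (m * n) → F), IsAssociatedCode K C (familySubspace K A h) →
      IsMRDCode K C (m * (h + 1)) (n - h) ∧
      ∀ C' : Submodule F (Fin (m * n) → F), IsKnownCode K C' → ¬ CodeEquivalent K C C' := by
  refine ⟨?_, fun C hC => ⟨?_, ?_⟩⟩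
  · have hfin : finrank K (familySubspace K A h) = m * n := by
      rw [finrank_familySubspace (by omega), hn]
    let u : Basis (Fin (m * n)) K (familySubspace K A h) := finBasisOfFinrankEq K _ hfin
    exact ⟨LinearMap.range (evalForms fun j => (u j : _ → F)),
      span_familySubspace (by omega) (by omega) hA, u, fun c => exists_congr fun v => eq_comm⟩
  · exact isMRDCode_of_isAssociatedCode hn (by omega) (by omega) (by omega) hA hC
  · rintro C' ⟨h', k, U', hU', hC'⟩ hCC'
    obtain ⟨Φ, rfl⟩ := exists_equiv_of_codeEquivalent hC hC' hCC'
    exact not_isKnownMaxScattered (by omega) h2 (by omega) hA Φ hU'
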